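/- Let $P$ be a finite set of players and let $k\ge 1$ be an integer. For each player $p\in P$ let $S_p$ be a finite non-empty set of strategies, and let $u_p^1,\dots,u_p^k:\prod_{q\in P}S_q\to\mathbb{R}$ be payoff functions; these data form a (finite) min-$k$-game. A mixed strategy of player $p$ is a probability distribution $\sigma_p$ on $S_p$. A play $\sigma=\prod_{p\in P}\sigma_p$ is a choice of a mixed strategy for every player, regarded as the product distribution on $\prod_{p\in P}S_p$. The payoff to player $p$ from the play $\sigma$ is \[ \operatorname{pay}_p(\sigma)=\min\bigl\{\mathbb{E}[u_p^1(X)],\dots,\mathbb{E}[u_p^k(X)]\bigr\}, \] where $X$ is a random strategy profile with law $\sigma$. Then there is a play $\sigma$ that is an equilibrium: for every player $p\in P$ and every mixed strategy $\sigma_p'$ of $p$, \[ \operatorname{pay}_p(\sigma')\le\operatorname{pay}_p(\sigma), \] where $\sigma'$ is obtained from $\sigma$ by replacing $\sigma_p$ with $\sigma_p'$ and leaving the mixed strategies of all other players unchanged. -/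

import Mathlib

/-- A min-`k`-game with players `P`: every player `p` has a type `S p` of (pure) strategies and
`k` payoff functions `u p 0, …, u p (k - 1)` on the strategy profiles. -/
structure MinGame (P : Type*) (k : ℕ) where
  /-- The strategies of each player. -/
  S : P → Type*
  /-- The `k` payoff functions of each player. -/
  u : P → Fin k → (∀ q, S q) → ℝ

namespace MinGame

section

variable {P : Type*} [Fintype P] {k : ℕ} (G : MinGame P k) [∀ p, Fintype (G.S p)]

/-- A mixed strategy of player `p` is a probability distribution on the finite set `S p`. -/
abbrev MixedStrategy (p : P) : Type _ := stdSimplex ℝ (G.S p)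

/-- A play is given by a mixed strategy for each player; the corresponding product distribution
on strategy profiles is `MinGame.law`. -/
abbrev Play : Type _ := ∀ p, G.MixedStrategy p

variable {G} [DecidableEq P]

/-- The product distribution of a play: the joint law of independent random choices, the one of
player `p` having law `σ p`. -/
noncomputable def law (σ : G.Play) : stdSimplex ℝ (∀ p, G.S p) :=
  ⟨fun s => ∏ p, (σ p).1 (s p),
    fun s => Finset.prod_nonneg fun p _ => (σ p).2.1 (s p), by
      rw [← Fintype.prod_sum fun p x => (σ p).1 x]
      exact Finset.prod_eq_one fun p _ => (σ p).2.2⟩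

/-- The expectation of a function of the strategy profile under a play. -/
noncomputable def expectation (σ : G.Play) (f : (∀ p, G.S p) → ℝ) : ℝ :=
  ∑ s, (law σ).1 s * f s

/-- The payoff to player `p`: the minimum of her `k` expected payoffs. -/
noncomputable def payoff [NeZero k] (σ : G.Play) (p : P) : ℝ :=
  Finset.univ.inf' Finset.univ_nonempty fun i : Fin k => expectation σ (G.u p i)

/-- Player `p` tolerates `σ` if replacing her mixed strategy alone never raises her payoff. -/
def Tolerates [NeZero k] (p : P) (σ : G.Play) : Prop :=
  ∀ τ : G.MixedStrategy p, payoff (Function.update σ p τ) p ≤ payoff σ p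

/-- An equilibrium is a play tolerated by every player. -/
def IsEquilibrium [NeZero k] (σ : G.Play) : Prop :=
  ∀ p, Tolerates p σ

end

end MinGame

/-! For plays σ and τ, `MinGame.totalGain` adds up the gains of the players when each switches alone
from σ to τ. Each expected payoff is linear in a player's own mixed strategy, and a minimum of
linear functions is concave; so the total gain is concave in τ. It is also continuous in σ and zero
for τ = σ. The Ky Fan inequality then gives a σ from which no τ has positive total gain, and a τ
differing from σ in one player only yields the equilibrium condition.

Ky Fan is derived from Brouwer's theorem on a simplex: if it failed, finitely many τ would improve
on every σ, and weighting them by their positive gains would give a self-map whose fixed point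
contradicts concavity. Brouwer is derived from Scarf's lemma, where dominating sets for the
coordinate rankings of a grid replace the cells of a triangulation and a Sperner-type parity count
finds one with all colours. -/

/-! ### Parity of the doors of a room -/

open Finset in
/-- Removing one point from a set `R` with as many points as there are colours leaves exactly the
colours other than `i₀` for an odd number of choices iff `R` carries all colours. -/
theorem odd_card_filter_image_erase_iff {V I : Type*} [DecidableEq V] [Fintype I] [DecidableEq I]
    (c : V → I) (i₀ : I) {R : Finset V} (hR : #R = Fintype.card I) :
    Odd #{x ∈ R | (R.erase x).image c = univ.erase i₀} ↔ R.image c = univ := by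
  constructor
  · intro hodd
    by_contra hne
    obtain ⟨x, hx⟩ := card_pos.1 hodd.pos
    obtain ⟨hxR, hx⟩ := mem_filter.1 hx
    have hinj : Set.InjOn c (R.erase x : Finset V) := by
      apply injOn_of_card_image_eq
      rw [hx, card_erase_of_mem hxR, card_erase_of_mem (mem_univ _), hR, card_univ]
    have hcx : c x ≠ i₀ := by
      intro h
      apply hne
      rw [← insert_erase hxR, image_insert, hx, h, insert_erase (mem_univ _)]
    have hmem : c x ∈ (R.erase x).image c := by rw [hx]; simp [hcx]
    obtain ⟨y, hy, hyx⟩ := mem_image.1 hmem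
    have hyR := mem_of_mem_erase hy
    have hxy : x ≠ y := (ne_of_mem_erase hy).symm
    -- The colour of `x` is repeated exactly once, at `y`; these two are interchangeable and no
    -- other point can be spared.
    have hF : {x ∈ R | (R.erase x).image c = univ.erase i₀} = {x, y} := by
      ext z
      simp only [mem_filter, mem_insert, mem_singleton]
      constructor
      · rintro ⟨hzR, hz⟩
        by_contra! hcon
        have hzx : z ∈ R.erase x := mem_erase.2 ⟨hcon.1, hzR⟩
        have h1 : c z ∈ (R.erase z).image c := by
          rw [hz, ← hx]; exact mem_image_of_mem c hzx
        obtain ⟨w, hw, hwz⟩ := mem_image.1 h1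
        by_cases hwx : w = x
        · subst hwx
          exact hcon.2 (hinj hzx hy (by rw [← hwz, hyx]))
        · exact (ne_of_mem_erase hw) (hinj (mem_erase.2 ⟨hwx, mem_of_mem_erase hw⟩) hzx hwz)
      · rintro (rfl | rfl)
        · exact ⟨hxR, hx⟩
        · refine ⟨hyR, ?_⟩
          rw [← hx, ← insert_erase (mem_erase.2 ⟨hxy, hxR⟩), ← insert_erase hy, image_insert,
            image_insert, hyx, erase_right_comm]
    rw [hF, card_pair hxy] at hodd
    exact absurd hodd (by decide)
  · intro him
    have hinj : Set.InjOn c R := by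
      apply injOn_of_card_image_eq
      rw [him, hR, card_univ]
    obtain ⟨x, hxR, hx⟩ := mem_image.1 (him ▸ mem_univ i₀ : i₀ ∈ R.image c)
    have hF : {x ∈ R | (R.erase x).image c = univ.erase i₀} = {x} := by
      ext z
      simp only [mem_filter, mem_singleton]
      constructor
      · rintro ⟨hzR, hz⟩
        by_contra hzx
        have : c x ∈ (R.erase z).image c :=
          mem_image_of_mem c (mem_erase.2 ⟨fun h => hzx h.symm, hxR⟩)
        rw [hz, hx] at this
        exact notMem_erase _ _ this
      · rintro rfl
        refine ⟨hxR, ?_⟩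
        ext j
        simp only [mem_image, mem_erase, mem_univ, and_true]
        constructor
        · rintro ⟨w, ⟨hwz, hw⟩, rfl⟩ h
          exact hwz (hinj hw hxR (h.trans hx.symm))
        · intro hj
          obtain ⟨w, hw, rfl⟩ := mem_image.1 (him ▸ mem_univ j : j ∈ R.image c)
          exact ⟨w, ⟨fun h => hj (h ▸ hx), hw⟩, rfl⟩
    rw [hF, card_singleton]
    exact odd_one

/-! ### Scarf's lemma on dominating sets -/

namespace Scarf

variable {V I α : Type*} [LinearOrder α]

/-- No point of `V` lies strictly above the minimum of `E` for all the rankings `r i` at once. -/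
def Dominating (r : I → V → α) (E : Finset V) : Prop :=
  ∀ x, ∃ i, ∀ y ∈ E, r i x ≤ r i y

theorem Dominating.mono {r : I → V → α} {E F : Finset V} (h : Dominating r F) (hEF : E ⊆ F) :
    Dominating r E := fun x => (h x).imp fun _ hi y hy => hi y (hEF hy)

/-- `x` lies strictly above the minimum of `E` for all the rankings except possibly `r k`. -/
def AboveExcept (r : I → V → α) (E : Finset V) (k : I) (x : V) : Prop :=
  ∀ l, l ≠ k → ∃ y ∈ E, r l y < r l x

/-- `x` is the highest point for `r k` among those satisfying `AboveExcept r E k`. -/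
def IsPivot (r : I → V → α) (E : Finset V) (k : I) (x : V) : Prop :=
  AboveExcept r E k x ∧ ∀ y, AboveExcept r E k y → r k y ≤ r k x

theorem AboveExcept.exists_isPivot [Finite V] {r : I → V → α} {E : Finset V} {k : I} {x : V}
    (hx : AboveExcept r E k x) : ∃ z, IsPivot r E k z := by
  classical
  cases nonempty_fintype V
  obtain ⟨z, hz, hmax⟩ := Finset.exists_max_image
    (Finset.univ.filter fun y => AboveExcept r E k y) (r k) ⟨x, by simpa using hx⟩
  exact ⟨z, by simpa using hz, fun y hy => hmax y (by simpa using hy)⟩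

theorem IsPivot.eq {r : I → V → α} (hr : ∀ i, Function.Injective (r i)) {E : Finset V} {k : I}
    {x y : V} (hx : IsPivot r E k x) (hy : IsPivot r E k y) : x = y :=
  hr k (le_antisymm (hy.2 x hx.1) (hx.2 y hy.1))

/-- The exchange step: a dominating set one point short of `Fintype.card I` has two critical
rankings, and the points that can be added to it are the pivots for these. -/
theorem Dominating.exists_pair [DecidableEq V] [Fintype I] {r : I → V → α}
    (hr : ∀ i, Function.Injective (r i)) {E : Finset V} (hE : Dominating r E)
    (hne : E.Nonempty) (hcard : E.card + 1 = Fintype.card I) :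
    ∃ a b, a ≠ b ∧ (∃ e ∈ E, ∀ y ∈ E, r a e ≤ r a y ∧ r b e ≤ r b y) ∧
      (∀ x, ¬ (IsPivot r E a x ∧ IsPivot r E b x)) ∧
      ∀ x, (x ∉ E ∧ Dominating r (insert x E)) ↔ IsPivot r E a x ∨ IsPivot r E b x := by
  classical
  have hmin : ∀ i, ∃ e ∈ E, ∀ y ∈ E, r i e ≤ r i y := fun i => E.exists_min_image (r i) hne
  choose m hmE hm using hmin
  have hmeq : ∀ i, ∀ e ∈ E, (∀ y ∈ E, r i e ≤ r i y) → m i = e := fun i e he h =>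
    hr i (le_antisymm (hm i e he) (h _ (hmE i)))
  -- Domination makes every point of `E` a minimum `m i`, so it takes at least `E.card` rankings to
  -- cover `E`.
  have hsmall : ∀ S : Finset I, S.card + 1 < Fintype.card I → ¬ E ⊆ S.image m := by
    intro S hS hsub
    have h1 := Finset.card_le_card hsub
    have h2 := Finset.card_image_le (s := S) (f := m)
    omega
  obtain ⟨a, -, b, -, hab, hmab⟩ : ∃ a ∈ (Finset.univ : Finset I), ∃ b ∈ Finset.univ,
      a ≠ b ∧ m a = m b :=
    Finset.exists_ne_map_eq_of_card_lt_of_maps_to (t := E)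
      (by rw [Finset.card_univ]; omega) (fun i _ => hmE i)
  have hpair : ∀ k l : I, k ≠ l → ((Finset.univ.erase k).erase l).card + 1 < Fintype.card I := by
    intro k l hkl
    have h2 : 2 ≤ Fintype.card I := by have := hne.card_pos; omega
    rw [Finset.card_erase_of_mem (by simp [hkl.symm]), Finset.card_erase_of_mem (by simp),
      Finset.card_univ]
    omega
  have hnot : ∀ x, ¬ ∀ i, ∃ y ∈ E, r i y < r i x := by
    intro x h
    obtain ⟨i, hi⟩ := hE x
    obtain ⟨y, hy, hlt⟩ := h i
    exact absurd (hi y hy) (not_le.2 hlt)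
  -- every point of `E` is the minimum for some ranking other than a critical one
  have hcover : ∀ k, k = a ∨ k = b → ∀ e ∈ E, ∃ i, i ≠ k ∧ m i = e := by
    intro k hk e he
    obtain ⟨i, hi⟩ := hE e
    have hie := hmeq i e he hi
    by_cases hik : i = k
    · rcases hk with rfl | rfl
      · exact ⟨b, hab.symm, by rw [← hmab, ← hik, hie]⟩
      · exact ⟨a, hab, by rw [hmab, ← hik, hie]⟩
    · exact ⟨i, hik, hie⟩
  have hforward : ∀ k, k = a ∨ k = b → ∀ x, IsPivot r E k x →
      x ∉ E ∧ Dominating r (insert x E) := by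
    intro k hk x hx
    refine ⟨fun hxE => ?_, fun y => ?_⟩
    · obtain ⟨i, hik, rfl⟩ := hcover k hk x hxE
      obtain ⟨y, hy, hlt⟩ := hx.1 i hik
      exact absurd (hm i y hy) (not_le.2 hlt)
    -- A point `y` above the minima of `insert x E` competes with the pivot `x`, so it is no higher
    -- than `x` for `r k`. Then `x` itself lies above the minimum of `E` for every ranking.
    · by_contra! hcon
      have hy : AboveExcept r E k y := by
        intro l hl
        obtain ⟨z, hz, hlt⟩ := hcon l
        rcases Finset.mem_insert.1 hz with rfl | hz
        · obtain ⟨w, hw, hwz⟩ := hx.1 l hl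
          exact ⟨w, hw, hwz.trans hlt⟩
        · exact ⟨z, hz, hlt⟩
      have hyx := hx.2 y hy
      obtain ⟨z, hz, hlt⟩ := hcon k
      rcases Finset.mem_insert.1 hz with rfl | hz
      · exact absurd hyx (not_le.2 hlt)
      · refine hnot x fun i => ?_
        by_cases hik : i = k
        · subst hik; exact ⟨z, hz, hlt.trans_le hyx⟩
        · exact hx.1 i hik
  refine ⟨a, b, hab, ⟨m a, hmE a, fun y hy => ⟨hm a y hy, hmab ▸ hm b y hy⟩⟩, ?_, ?_⟩
  · rintro x ⟨ha, hb⟩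
    refine hnot x fun i => ?_
    by_cases hia : i = a
    · exact hb.1 i (hia ▸ hab)
    · exact ha.1 i hia
  · refine fun x => ⟨?_, fun h => h.elim (hforward a (.inl rfl) x) (hforward b (.inr rfl) x)⟩
    rintro ⟨hxE, hdom⟩
    have hbelow : ∀ e ∈ E, ∃ i, m i = e ∧ r i e < r i x := by
      intro e he
      obtain ⟨i, hi⟩ := hdom e
      refine ⟨i, hmeq i e he fun y hy => hi y (Finset.mem_insert_of_mem hy), ?_⟩
      refine lt_of_le_of_ne (hi x (Finset.mem_insert_self _ _)) fun h => hxE (hr i h ▸ he)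
    -- The ranking `k` has `x` as its minimum on `insert x E`, so it cannot witness `hbelow`.
    -- Excluding one further ranking leaves too few to cover `E`.
    obtain ⟨k, hk⟩ := hdom x
    have habove : AboveExcept r E k x := by
      intro l hl
      by_contra! hcon
      refine hsmall _ (hpair k l hl.symm) fun e he => ?_
      obtain ⟨i, hie, hlt⟩ := hbelow e he
      refine Finset.mem_image.2 ⟨i, ?_, hie⟩
      simp only [Finset.mem_erase, Finset.mem_univ, and_true]
      refine ⟨fun h => ?_, fun h => ?_⟩
      · exact absurd (hcon e he) (not_le.2 (h ▸ hlt))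
      · exact absurd (hk e (Finset.mem_insert_of_mem he)) (not_le.2 (h ▸ hlt))
    have hpivot : IsPivot r E k x := by
      refine ⟨habove, fun y hy => ?_⟩
      obtain ⟨i, hi⟩ := hdom y
      by_cases hik : i = k
      · exact hik ▸ hi x (Finset.mem_insert_self _ _)
      · obtain ⟨z, hz, hlt⟩ := hy i hik
        exact absurd (hi z (Finset.mem_insert_of_mem hz)) (not_le.2 hlt)
    by_cases hka : k = a
    · exact .inl (hka ▸ hpivot)
    by_cases hkb : k = b
    · exact .inr (hkb ▸ hpivot)
    -- If `k` were not critical, the rankings other than `k` and `a` would still cover `E`, since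
    -- `b` can replace `a`.
    exfalso
    refine hsmall _ (hpair k a hka) fun e he => ?_
    obtain ⟨i, hie, hlt⟩ := hbelow e he
    have hik : i ≠ k := by
      intro h
      exact absurd (hk e (Finset.mem_insert_of_mem he)) (not_le.2 (h ▸ hlt))
    by_cases hia : i = a
    · exact Finset.mem_image.2 ⟨b, by simp [hab.symm, Ne.symm hkb], by rw [← hmab, ← hia, hie]⟩
    · exact Finset.mem_image.2 ⟨i, by simp [hia, hik], hie⟩

/-- The points `s i` are slack points for the rankings `r`: `s i` is the lowest point for `r i`
and lies above all non-slack points for the other rankings. -/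
structure IsSlack (r : I → V → α) (s : I → V) : Prop where
  lt_of_ne : ∀ i v, v ≠ s i → r i (s i) < r i v
  lt_of_notMem : ∀ i j v, i ≠ j → v ∉ Set.range s → r i v < r i (s j)

theorem IsSlack.dominating_boundary [DecidableEq V] [Fintype I] [DecidableEq I]
    {r : I → V → α} {s : I → V} (hs : IsSlack r s) (i₀ : I) :
    Dominating r ((Finset.univ.erase i₀).image s) := by
  intro x
  by_cases hx : ∃ i, x = s i
  · obtain ⟨i, rfl⟩ := hx
    refine ⟨i, fun y _ => ?_⟩
    by_cases hy : y = s i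
    · rw [hy]
    · exact (hs.lt_of_ne i y hy).le
  · refine ⟨i₀, fun y hy => ?_⟩
    obtain ⟨l, hl, rfl⟩ := Finset.mem_image.1 hy
    exact (hs.lt_of_notMem i₀ l x (Finset.ne_of_mem_erase hl).symm
      fun ⟨i, hi⟩ => hx ⟨i, hi.symm⟩).le

section

variable [Fintype V] [DecidableEq V] [Fintype I] {r : I → V → α} {s : I → V}

/-- A non-slack `e` in `E` lies below `s k` for every ranking but `r k`, so both critical rankings
have a pivot, and the two pivots differ. -/
theorem IsSlack.card_extensions_of_interior [DecidablePred (Dominating r)]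
    (hs : IsSlack r s)
    (hr : ∀ i, Function.Injective (r i)) {E : Finset V} (hE : Dominating r E)
    (hcard : E.card + 1 = Fintype.card I) {e : V} (he : e ∈ E) (hes : e ∉ Set.range s) :
    (Finset.univ.filter fun x => x ∉ E ∧ Dominating r (insert x E)).card = 2 := by
  obtain ⟨a, b, -, -, hdisj, hiff⟩ := hE.exists_pair hr ⟨e, he⟩ hcard
  have hex : ∀ k, ∃ z, IsPivot r E k z := fun k =>
    AboveExcept.exists_isPivot (x := s k) fun l hl => ⟨e, he, hs.lt_of_notMem l k e hl hes⟩
  obtain ⟨x, hx⟩ := hex a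
  obtain ⟨y, hy⟩ := hex b
  have hxy : x ≠ y := by rintro rfl; exact hdisj x ⟨hx, hy⟩
  rw [← Finset.card_pair hxy]
  congr 1
  ext z
  simp only [Finset.mem_filter, Finset.mem_univ, true_and, Finset.mem_insert,
    Finset.mem_singleton, hiff z]
  constructor
  · rintro (h | h)
    · exact .inl (h.eq hr hx)
    · exact .inr (h.eq hr hy)
  · rintro (rfl | rfl)
    · exact .inl hx
    · exact .inr hy

/-- For `k ≠ i₀` the minimum of `E` is `s k`. Critical rankings share their minimum and `s` is
injective, so one of them is `i₀`; the other has no pivot. The non-slack `v` ensures that `i₀` has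
one. -/
theorem IsSlack.card_extensions_boundary [DecidableEq I] [Nontrivial I]
    [DecidablePred (Dominating r)] (hs : IsSlack r s)
    (hr : ∀ i, Function.Injective (r i)) (hinj : Function.Injective s) (i₀ : I)
    {v : V} (hv : v ∉ Set.range s) :
    (Finset.univ.filter fun x => x ∉ (Finset.univ.erase i₀).image s ∧
      Dominating r (insert x ((Finset.univ.erase i₀).image s))).card = 1 := by
  set E := (Finset.univ.erase i₀).image s with hEdef
  have hsE : ∀ l, l ≠ i₀ → s l ∈ E := fun l hl => Finset.mem_image_of_mem s (by simpa using hl)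
  have hne : E.Nonempty := by
    obtain ⟨l, hl⟩ := exists_ne i₀
    exact ⟨_, hsE l hl⟩
  have hcard : E.card + 1 = Fintype.card I := by
    rw [Finset.card_image_of_injective _ hinj, Finset.card_erase_add_one (Finset.mem_univ _),
      Finset.card_univ]
  have hmin : ∀ k, k ≠ i₀ → ∀ e, (∀ y ∈ E, r k e ≤ r k y) → e = s k := by
    intro k hk e h
    by_contra hek
    exact absurd (h _ (hsE k hk)) (not_le.2 (hs.lt_of_ne k e hek))
  -- only the ranking `i₀` has a pivot
  have hempty : ∀ b, (∀ y ∈ E, r i₀ (s b) ≤ r i₀ y) → ∀ x, b ≠ i₀ → ¬ AboveExcept r E b x := by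
    intro b hb x hbi hx
    obtain ⟨y, hy, hlt⟩ := hx i₀ hbi.symm
    obtain ⟨l, hl, rfl⟩ := Finset.mem_image.1 hy
    by_cases hxr : x ∈ Set.range s
    · obtain ⟨k, rfl⟩ := hxr
      by_cases hkb : k = b
      · exact absurd (hb _ hy) (not_le.2 (hkb ▸ hlt))
      · obtain ⟨z, -, hz⟩ := hx k hkb
        by_cases hzk : z = s k
        · exact absurd hz (by simp [hzk])
        · exact absurd (hs.lt_of_ne k z hzk) hz.asymm
    · exact hlt.asymm (hs.lt_of_notMem i₀ l x (Finset.ne_of_mem_erase hl).symm hxr)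
  obtain ⟨x, hx⟩ : ∃ x, IsPivot r E i₀ x := AboveExcept.exists_isPivot (x := v) fun l hl =>
    ⟨s l, hsE l hl, hs.lt_of_ne l v fun h => hv ⟨l, h.symm⟩⟩
  obtain ⟨a, b, hab, ⟨e, heE, he⟩, -, hiff⟩ :=
    (hs.dominating_boundary i₀).exists_pair hr hne hcard
  have key : ∀ z, IsPivot r E a z ∨ IsPivot r E b z ↔ IsPivot r E i₀ z := by
    intro z
    by_cases ha : a = i₀
    · have hb : b ≠ i₀ := fun h => hab (ha.trans h.symm)
      have heb := hmin b hb e fun y hy => (he y hy).2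
      have hno := hempty b (fun y hy => heb ▸ ha ▸ (he y hy).1) z hb
      rw [ha]
      exact ⟨fun h => h.resolve_right fun h => hno h.1, .inl⟩
    · have hea := hmin a ha e fun y hy => (he y hy).1
      have hb : b = i₀ := by
        by_contra hb
        exact hab (hinj (hea.symm.trans (hmin b hb e fun y hy => (he y hy).2)))
      have hno := hempty a (fun y hy => hea ▸ hb ▸ (he y hy).2) z ha
      rw [hb]
      exact ⟨fun h => h.resolve_left fun h => hno h.1, .inr⟩
  rw [Finset.card_eq_one]
  refine ⟨x, ?_⟩
  ext z
  simp only [Finset.mem_filter, Finset.mem_univ, true_and, Finset.mem_singleton]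
  rw [hiff z, key z]
  exact ⟨fun h => h.eq hr hx, fun h => h ▸ hx⟩

theorem card_supersets_eq_card_insert (p : Finset V → Prop) [DecidablePred p] (E : Finset V) {n : ℕ}
    (hn : E.card + 1 = n) :
    (Finset.univ.filter fun R => (p R ∧ R.card = n) ∧ E ⊆ R).card =
      (Finset.univ.filter fun x => x ∉ E ∧ p (insert x E)).card := by
  symm
  apply Finset.card_nbij (fun x => insert x E)
  · intro x hx
    simp only [Finset.mem_coe, Finset.mem_filter, Finset.mem_univ, true_and] at hx ⊢
    exact ⟨⟨hx.2, by rw [Finset.card_insert_of_notMem hx.1, hn]⟩, Finset.subset_insert _ _⟩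
  · intro x hx y hy hxy
    simp only [Finset.mem_coe, Finset.mem_filter, Finset.mem_univ, true_and] at hx hy
    have : x ∈ insert y E := by
      have h : x ∈ insert x E := Finset.mem_insert_self _ _
      rwa [show insert x E = insert y E from hxy] at h
    exact (Finset.mem_insert.1 this).resolve_right hx.1
  · intro R hR
    simp only [Finset.mem_coe, Finset.mem_filter, Finset.mem_univ, true_and] at hR
    obtain ⟨⟨hR, hRc⟩, hsub⟩ := hR
    obtain ⟨x, hx⟩ : ∃ x, R \ E = {x} := by
      rw [← Finset.card_eq_one, Finset.card_sdiff_of_subset hsub]; omega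
    have hins : insert x E = R := by
      rw [Finset.insert_eq, ← hx, Finset.sdiff_union_of_subset hsub]
    have hxE : x ∉ E := by
      have : x ∈ R \ E := by simp [hx]
      exact (Finset.mem_sdiff.1 this).2
    exact ⟨x, by simpa [hxE, hins] using hR, hins⟩

theorem card_subsets_eq_card_erase (p : Finset V → Prop) [DecidablePred p] (R : Finset V) {n : ℕ}
    (hn : R.card = n) :
    (Finset.univ.filter fun E => (p E ∧ E.card + 1 = n) ∧ E ⊆ R).card =
      (R.filter fun x => p (R.erase x)).card := by
  symm
  apply Finset.card_nbij (fun x => R.erase x)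
  · intro x hx
    simp only [Finset.mem_coe, Finset.mem_filter, Finset.mem_univ, true_and] at hx ⊢
    exact ⟨⟨hx.2, by rw [Finset.card_erase_add_one hx.1, hn]⟩, Finset.erase_subset _ _⟩
  · intro x hx y hy hxy
    simp only [Finset.mem_coe, Finset.mem_filter] at hx hy
    exact Finset.erase_injOn R hx.1 hy.1 hxy
  · intro E hE
    simp only [Finset.mem_coe, Finset.mem_filter, Finset.mem_univ, true_and] at hE
    obtain ⟨⟨hp, hEc⟩, hsub⟩ := hE
    obtain ⟨x, hx⟩ : ∃ x, R \ E = {x} := by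
      rw [← Finset.card_eq_one, Finset.card_sdiff_of_subset hsub]; omega
    have hxR : x ∈ R := by
      have : x ∈ R \ E := by simp [hx]
      exact (Finset.mem_sdiff.1 this).1
    have her : R.erase x = E := by
      rw [Finset.erase_eq, ← hx, Finset.sdiff_sdiff_eq_self hsub]
    exact ⟨x, by simpa [hxR, her] using hp, her⟩

/-- The lemma of Scarf: there is a dominating set carrying all colours. -/
theorem IsSlack.exists_dominating_image_eq_univ [DecidableEq I] [Nontrivial I] (hs : IsSlack r s)
    (hr : ∀ i, Function.Injective (r i)) {v : V} (hv : v ∉ Set.range s)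
    (c : V → I) (hc : ∀ i, c (s i) = i) :
    ∃ R : Finset V, Dominating r R ∧ R.image c = Finset.univ := by
  classical
  obtain ⟨i₀⟩ : Nonempty I := inferInstance
  have hinj : Function.Injective s := Function.LeftInverse.injective hc
  -- Incidences of doors and rooms are counted twice. Only the boundary door lies in an odd number
  -- of rooms, while a room has an odd number of doors iff it carries all colours.
  obtain ⟨doors, hdoors⟩ : ∃ D : Finset (Finset V), D = Finset.univ.filter fun E =>
    (Dominating r E ∧ E.image c = Finset.univ.erase i₀) ∧ E.card + 1 = Fintype.card I := ⟨_, rfl⟩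
  obtain ⟨rooms, hrooms⟩ : ∃ D : Finset (Finset V), D = Finset.univ.filter fun R =>
    Dominating r R ∧ R.card = Fintype.card I := ⟨_, rfl⟩
  have memdoors : ∀ E, E ∈ doors ↔ (Dominating r E ∧ E.image c = Finset.univ.erase i₀) ∧
    E.card + 1 = Fintype.card I := fun E => by rw [hdoors, Finset.mem_filter_univ]
  have memrooms : ∀ R, R ∈ rooms ↔ Dominating r R ∧ R.card = Fintype.card I :=
    fun R => by rw [hrooms, Finset.mem_filter_univ]
  have hdoor : ∀ E ∈ doors, (rooms.filter fun R => E ⊆ R).card =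
      (Finset.univ.filter fun x => x ∉ E ∧ Dominating r (insert x E)).card := by
    intro E hE
    rw [hrooms, Finset.filter_filter]
    exact card_supersets_eq_card_insert (Dominating r) E ((memdoors E).1 hE).2
  have hroom : ∀ R ∈ rooms, (doors.filter fun E => E ⊆ R).card =
      (R.filter fun x => (R.erase x).image c = Finset.univ.erase i₀).card := by
    intro R hR
    rw [memrooms] at hR
    rw [hdoors, Finset.filter_filter, card_subsets_eq_card_erase
      (fun E => Dominating r E ∧ E.image c = Finset.univ.erase i₀) R hR.2]
    congr 1
    refine Finset.filter_congr fun x _ => ?_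
    exact and_iff_right (hR.1.mono (Finset.erase_subset _ _))
  have hboundary : (Finset.univ.erase i₀).image s ∈ doors := by
    refine (memdoors _).2 ⟨⟨hs.dominating_boundary i₀, ?_⟩, ?_⟩
    · rw [Finset.image_image, show c ∘ s = id from funext hc, Finset.image_id]
    · rw [Finset.card_image_of_injective _ hinj,
        Finset.card_erase_add_one (Finset.mem_univ _), Finset.card_univ]
  have hodd : Odd (∑ E ∈ doors, (rooms.filter fun R => E ⊆ R).card) := by
    rw [Finset.odd_sum_iff_odd_card_odd]
    have : {E ∈ doors | Odd (rooms.filter fun R => E ⊆ R).card} =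
        {(Finset.univ.erase i₀).image s} := by
      ext E
      rw [Finset.mem_filter, Finset.mem_singleton]
      constructor
      · rintro ⟨hE, hodd⟩
        rw [hdoor E hE] at hodd
        obtain ⟨⟨hdom, him⟩, hEc⟩ := (memdoors E).1 hE
        have hall : ∀ e ∈ E, e ∈ Set.range s := by
          by_contra! hcon
          obtain ⟨e, he, hes⟩ := hcon
          rw [hs.card_extensions_of_interior hr hdom hEc he hes] at hodd
          exact Nat.not_odd_iff_even.2 even_two hodd
        -- A set of slack points is recovered from its colours, because `c (s i) = i`.
        rw [← him, Finset.image_image]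
        ext e
        constructor
        · intro he
          obtain ⟨i, rfl⟩ := hall e he
          exact Finset.mem_image.2 ⟨s i, he, congrArg s (hc i)⟩
        · intro he
          obtain ⟨w, hw, rfl⟩ := Finset.mem_image.1 he
          obtain ⟨i, rfl⟩ := hall w hw
          rwa [Function.comp_apply, hc]
      · rintro rfl
        refine ⟨hboundary, ?_⟩
        rw [hdoor _ hboundary, hs.card_extensions_boundary hr hinj i₀ hv]
        exact odd_one
    rw [this, Finset.card_singleton]
    exact odd_one
  have hcomm : ∑ E ∈ doors, (rooms.filter fun R => E ⊆ R).card =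
      ∑ R ∈ rooms, (doors.filter fun E => E ⊆ R).card := by
    simp only [Finset.card_filter]
    exact Finset.sum_comm
  by_contra! hcon
  have heven : Even (∑ R ∈ rooms, (doors.filter fun E => E ⊆ R).card) := by
    refine Finset.even_sum _ fun R hR => ?_
    rw [hroom R hR, ← Nat.not_odd_iff_even,
      odd_card_filter_image_erase_iff c i₀ ((memrooms R).1 hR).2]
    exact hcon R ((memrooms R).1 hR).1
  rw [← hcomm, ← Nat.not_odd_iff_even] at heven
  exact heven hodd

end

end Scarf

/-! ### Scarf's lemma on the simplex grid -/

/-- The points of the simplex with numerators of sum `N` over the common denominator `N`. -/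
abbrev SimplexGrid (I : Type*) [Fintype I] [DecidableEq I] (N : ℕ) : Type _ :=
  ↥(Finset.piAntidiag (Finset.univ : Finset I) N)

namespace SimplexGrid

variable {I : Type*} [Fintype I] [DecidableEq I] {N : ℕ}

theorem sum_eq (t : SimplexGrid I N) : ∑ i, t.1 i = N :=
  (Finset.mem_piAntidiag.1 t.2).1

/-- The grid point with numerators `x`. -/
def mk (x : I → ℕ) (hx : ∑ i, x i = N) : SimplexGrid I N :=
  ⟨x, Finset.mem_piAntidiag.2 ⟨hx, fun i _ => Finset.mem_univ i⟩⟩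

/-- The ranking of grid points and slack points by the `i`-th coordinate, with ties broken. -/
noncomputable def rank (i : I) : SimplexGrid I N ⊕ I → ℕ ×ₗ ℕ
  | .inl t => toLex (t.1 i + 1, Fintype.equivFin (SimplexGrid I N) t)
  | .inr j => if i = j then toLex (0, 0) else toLex (N + 2, Fintype.equivFin I j)

theorem coord_le (t : SimplexGrid I N) (i : I) : t.1 i ≤ N :=
  (Finset.single_le_sum (f := t.1) (fun _ _ => Nat.zero_le _) (Finset.mem_univ i)).trans_eq t.sum_eq

theorem rank_injective (i : I) : Function.Injective (rank (N := N) i) := by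
  rintro (t | j) (t' | j') h
  · simp only [rank, EmbeddingLike.apply_eq_iff_eq, Prod.mk.injEq, Fin.val_inj] at h
    rw [h.2]
  · have := t.coord_le i
    simp only [rank] at h
    split_ifs at h <;> simp only [EmbeddingLike.apply_eq_iff_eq, Prod.mk.injEq] at h <;> omega
  · have := t'.coord_le i
    simp only [rank] at h
    split_ifs at h <;> simp only [EmbeddingLike.apply_eq_iff_eq, Prod.mk.injEq] at h <;> omega
  · simp only [rank] at h
    split_ifs at h with h1 h2 h2
    · rw [← h1, ← h2]
    · simp at h
    · simp at h
    · simp only [EmbeddingLike.apply_eq_iff_eq, Prod.mk.injEq, Fin.val_inj] at h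
      rw [h.2]

/-- Grid points have first entry between 1 and `N + 1`, hence strictly between the entries 0 and `N
+ 2` of the slack points. -/
theorem isSlack_rank : Scarf.IsSlack (rank (I := I) (N := N)) Sum.inr where
  lt_of_ne i v hv := by
    rcases v with t | j
    · simp [rank, Prod.Lex.toLex_lt_toLex]
    · have : i ≠ j := fun h => hv (by rw [h])
      simp [rank, Prod.Lex.toLex_lt_toLex, this]
  lt_of_notMem i j v hij hv := by
    rcases v with t | l
    · have := t.coord_le i
      simp only [rank, if_neg hij, Prod.Lex.toLex_lt_toLex]
      left; omega
    · exact absurd ⟨l, rfl⟩ hv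

theorem coord_le_of_rank_le {i : I} {t t' : SimplexGrid I N}
    (h : rank i (.inl t) ≤ rank i (.inl t')) : t.1 i ≤ t'.1 i := by
  simp only [rank, Prod.Lex.toLex_le_toLex] at h
  omega

/-- For every labelling of the grid by coordinates there is a grid point close to points of all
labels except those for which its coordinate is small. -/
theorem exists_near_all_labels [Nontrivial I] (c : SimplexGrid I N → I) :
    ∃ t : SimplexGrid I N, ∀ i, t.1 i ≤ Fintype.card I ∨
      ∃ t' : SimplexGrid I N, c t' = i ∧
        ∀ j, t.1 j ≤ t'.1 j + Fintype.card I ∧ t'.1 j ≤ t.1 j + Fintype.card I := by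
  classical
  obtain ⟨i₁⟩ : Nonempty I := inferInstance
  let v : SimplexGrid I N := mk (Pi.single i₁ N) (by simp)
  obtain ⟨R, hdom, him⟩ := isSlack_rank.exists_dominating_image_eq_univ
    (rank_injective (I := I) (N := N)) (v := .inl v) (by simp) (Sum.elim c id) (fun i => rfl)
  have hlabel : ∀ i, Sum.inr i ∉ R → ∃ t, Sum.inl t ∈ R ∧ c t = i := by
    intro i hi
    obtain ⟨w, hw, hwi⟩ := Finset.mem_image.1 (him ▸ Finset.mem_univ i)
    rcases w with t | j
    · exact ⟨t, hw, hwi⟩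
    · exact absurd ((show j = i from hwi) ▸ hw) hi
  have hnotMem : ∀ (x : SimplexGrid I N) (i : I), (∀ y ∈ R, rank i (.inl x) ≤ rank i y) →
      Sum.inr i ∉ R := fun x i h hi =>
    absurd (h _ hi) (not_le.2 (isSlack_rank.lt_of_ne i _ (by simp)))
  have hmin : ∀ i, ∃ μ : ℕ, (∀ t : SimplexGrid I N, Sum.inl t ∈ R → μ ≤ t.1 i) ∧
      (Sum.inr i ∈ R → μ = 0) ∧
      (Sum.inr i ∉ R → ∃ t : SimplexGrid I N, Sum.inl t ∈ R ∧ t.1 i = μ) := by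
    intro i
    by_cases hi : Sum.inr i ∈ R
    · exact ⟨0, fun _ _ => Nat.zero_le _, fun _ => rfl, fun h => absurd hi h⟩
    · obtain ⟨t, ht, -⟩ := hlabel i hi
      obtain ⟨m, hm, hmle⟩ := Finset.exists_min_image
        (Finset.univ.filter fun t : SimplexGrid I N => Sum.inl t ∈ R) (fun t => t.1 i)
        ⟨t, by simpa using ht⟩
      exact ⟨m.1 i, fun t ht => hmle t (by simpa using ht), fun h => absurd h hi,
        fun _ => ⟨m, by simpa using hm, rfl⟩⟩
  choose μ hμle hμzero hμmem using hmin
  -- Otherwise some grid point has every coordinate above `μ`, with the surplus put on `i₁`, and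
  -- violates domination.
  have hsum : N < ∑ i, μ i + Fintype.card I := by
    by_contra! hle
    have hx : ∑ i, (μ i + 1 + (Pi.single i₁ (N - (∑ i, μ i + Fintype.card I)) : I → ℕ) i) = N := by
      simp only [Finset.sum_add_distrib, Finset.sum_const, Finset.card_univ, smul_eq_mul, mul_one,
        Finset.sum_pi_single', Finset.mem_univ, if_true]
      omega
    obtain ⟨i, hi⟩ := hdom (.inl (mk _ hx))
    obtain ⟨t, ht, hti⟩ := hμmem i (hnotMem _ i hi)
    have := coord_le_of_rank_le (hi _ ht)
    simp only [mk] at this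
    omega
  -- The excesses over `μ` are nonnegative and sum to `N - ∑ μ`, which is less than the number of
  -- coordinates.
  have hupper : ∀ t : SimplexGrid I N, Sum.inl t ∈ R → ∀ j, t.1 j ≤ μ j + Fintype.card I := by
    intro t ht j
    have h1 : ∑ i, (t.1 i - μ i) + ∑ i, μ i = N := by
      rw [← Finset.sum_add_distrib]
      exact (Finset.sum_congr rfl fun i _ => Nat.sub_add_cancel (hμle i t ht)).trans t.sum_eq
    have h2 := Finset.single_le_sum (f := fun i => t.1 i - μ i) (fun _ _ => Nat.zero_le _)
      (Finset.mem_univ j)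
    omega
  -- Domination of a grid point shows that some slack point is missing from `R`; a grid point of `R`
  -- must carry its colour.
  obtain ⟨i₂, hi₂⟩ := hdom (.inl v)
  obtain ⟨t, ht, -⟩ := hlabel i₂ (hnotMem v i₂ hi₂)
  refine ⟨t, fun i => ?_⟩
  by_cases hi : Sum.inr i ∈ R
  · left
    have := hupper t ht i
    rwa [hμzero i hi, zero_add] at this
  · right
    obtain ⟨t', ht', hc⟩ := hlabel i hi
    refine ⟨t', hc, fun j => ?_⟩
    have h1 := hupper t ht j
    have h2 := hupper t' ht' j
    have h3 := hμle j t ht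
    have h4 := hμle j t' ht'
    omega

/-- A grid point as a point of the standard simplex. -/
noncomputable def toStdSimplex (hN : 0 < N) (t : SimplexGrid I N) : stdSimplex ℝ I :=
  ⟨fun i => t.1 i / N, fun i => by positivity, by
    rw [← Finset.sum_div, ← Nat.cast_sum, t.sum_eq, div_self (by positivity)]⟩

end SimplexGrid

/-! ### Brouwer's fixed point theorem -/

theorem stdSimplex.exists_le_apply {I : Type*} [Fintype I] [Nonempty I] (x y : stdSimplex ℝ I) :
    ∃ i, x.1 i ≤ y.1 i := by
  by_contra! h
  have := Finset.sum_lt_sum_of_nonempty Finset.univ_nonempty fun i (_ : i ∈ Finset.univ) => h i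
  rw [x.2.2, y.2.2] at this
  exact lt_irrefl _ this

/-- Each grid point is labelled by a coordinate that `f` does not decrease. At a point near all
labels, uniform continuity transfers the inequality from the labelled neighbours; a coordinate
lacking such a neighbour is below δ, where the bound is trivial. -/
theorem stdSimplex.exists_approx_fixedPoint {I : Type*} [Fintype I] [Nontrivial I]
    {f : stdSimplex ℝ I → stdSimplex ℝ I} (hf : Continuous f) {δ : ℝ} (hδ : 0 < δ) :
    ∃ x, ∀ i, x.1 i - δ ≤ (f x).1 i := by
  classical
  obtain ⟨η, hη, hfη⟩ := Metric.uniformContinuous_iff.1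
    (CompactSpace.uniformContinuous_of_continuous hf) (δ / 2) (by positivity)
  obtain ⟨N, hN⟩ := exists_nat_gt ((Fintype.card I : ℝ) / min (δ / 2) (η / 2))
  have hmin : 0 < min (δ / 2) (η / 2) := by positivity
  have hNpos : 0 < N := by
    have : (0 : ℝ) < N := lt_of_le_of_lt (by positivity) hN
    exact_mod_cast this
  have hNR : (0 : ℝ) < N := by exact_mod_cast hNpos
  have hsmall : (Fintype.card I : ℝ) / N < min (δ / 2) (η / 2) := by
    rw [div_lt_iff₀ hmin] at hN
    rw [div_lt_iff₀ hNR, mul_comm]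
    exact hN
  obtain ⟨hsδ, hsη⟩ := lt_min_iff.1 hsmall
  choose c hc using fun t : SimplexGrid I N =>
    stdSimplex.exists_le_apply (t.toStdSimplex hNpos) (f (t.toStdSimplex hNpos))
  obtain ⟨t, ht⟩ := SimplexGrid.exists_near_all_labels c
  have hcast : ∀ {a b : ℕ}, a ≤ b + Fintype.card I →
      (a : ℝ) / N ≤ b / N + (Fintype.card I : ℝ) / N := by
    intro a b hab
    rw [← add_div]
    gcongr
    exact_mod_cast hab
  refine ⟨t.toStdSimplex hNpos, fun i => ?_⟩
  rcases ht i with hi | ⟨t', rfl, hnear⟩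
  · have h1 : (t.1 i : ℝ) / N ≤ (Fintype.card I : ℝ) / N := by gcongr
    have h2 := (f (t.toStdSimplex hNpos)).2.1 i
    change (t.1 i : ℝ) / N - δ ≤ _
    linarith
  · have hdist : dist (t'.toStdSimplex hNpos) (t.toStdSimplex hNpos) < η := by
      refine lt_of_le_of_lt ?_ (half_lt_self hη)
      rw [Subtype.dist_eq, dist_pi_le_iff (by positivity)]
      intro j
      rw [Real.dist_eq, abs_le]
      have h1 := hcast (hnear j).1
      have h2 := hcast (hnear j).2
      change -(η / 2) ≤ (t'.1 j : ℝ) / N - t.1 j / N ∧ (t'.1 j : ℝ) / N - t.1 j / N ≤ η / 2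
      constructor <;> linarith
    have h1 := (dist_le_pi_dist _ _ (c t')).trans_lt (hfη hdist)
    rw [Real.dist_eq] at h1
    have h2 := (abs_lt.1 h1).2
    have h3 := hc t'
    have h4 := hcast (hnear (c t')).1
    change (t'.1 (c t') : ℝ) / N ≤ _ at h3
    change (t.1 (c t') : ℝ) / N - δ ≤ _
    linarith

/-- The **Brouwer fixed point theorem** for the standard simplex. -/
theorem stdSimplex.exists_fixedPoint {I : Type*} [Fintype I] [Nonempty I]
    {f : stdSimplex ℝ I → stdSimplex ℝ I} (hf : Continuous f) : ∃ x, f x = x := by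
  rcases subsingleton_or_nontrivial I with hI | hI
  · exact ⟨Classical.arbitrary _, Subsingleton.elim _ _⟩
  have hcont : ∀ i, Continuous fun x : stdSimplex ℝ I => x.1 i := fun i =>
    (continuous_apply i).comp continuous_subtype_val
  let g : stdSimplex ℝ I → ℝ := fun x =>
    Finset.univ.inf' Finset.univ_nonempty fun i => (f x).1 i - x.1 i
  have hg : Continuous g := Continuous.finset_inf'_apply _ fun i _ =>
    ((hcont i).comp hf).sub (hcont i)
  obtain ⟨x, -, hx⟩ := isCompact_univ.exists_isMaxOn Set.univ_nonempty hg.continuousOn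
  -- Approximate fixed points make the maximum of `g` nonnegative. Then `f x` dominates `x`
  -- coordinatewise, and equal coordinate sums force equality.
  have hnonneg : 0 ≤ g x := by
    refine le_of_forall_pos_lt_add fun ε hε => ?_
    obtain ⟨y, hy⟩ := stdSimplex.exists_approx_fixedPoint hf (half_pos hε)
    have h1 : g y ≤ g x := hx (Set.mem_univ y)
    have h2 : -(ε / 2) ≤ g y := Finset.le_inf' _ _ fun i _ => by linarith [hy i]
    linarith
  have hle : ∀ i ∈ Finset.univ, x.1 i ≤ (f x).1 i := fun i hi => by
    have := hnonneg.trans (Finset.inf'_le _ hi)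
    simpa using this
  refine ⟨x, Subtype.ext (funext fun i => ?_)⟩
  exact ((Finset.sum_eq_sum_iff_of_le hle).1 (by rw [x.2.2, (f x).2.2]) i (Finset.mem_univ i)).symm

/-! ### The Ky Fan inequality -/

/-- The **Ky Fan inequality**: if `C` is a compact space with a
continuous operation `comb` of convex combination of finitely many points, and `Φ` is concave in
the second variable, continuous in the first one and vanishes on the diagonal, then some `σ`
satisfies `Φ σ τ ≤ 0` for all `τ`. -/
theorem exists_forall_nonpos_of_concave {C : Type*} [TopologicalSpace C] [CompactSpace C]
    [Nonempty C] (comb : ∀ t : Finset C, stdSimplex ℝ t → C)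
    (hcomb : ∀ t, Continuous (comb t)) (Φ : C → C → ℝ) (hΦ : ∀ τ, Continuous fun σ => Φ σ τ)
    (hdiag : ∀ σ, Φ σ σ ≤ 0)
    (hconc : ∀ (t : Finset C) (w : stdSimplex ℝ t) (σ : C),
      ∑ i : t, w.1 i * Φ σ i.1 ≤ Φ σ (comb t w)) :
    ∃ σ, ∀ τ, Φ σ τ ≤ 0 := by
  by_contra! hcon
  obtain ⟨t, ht⟩ := isCompact_univ.elim_finite_subcover (fun τ => {σ | 0 < Φ σ τ})
    (fun τ => isOpen_lt continuous_const (hΦ τ))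
    (fun σ _ => Set.mem_iUnion.2 ((hcon σ).imp fun τ h => h))
  have hcover : ∀ σ, ∃ i : t, 0 < Φ σ i.1 := by
    intro σ
    obtain ⟨τ, hτ, h⟩ := Set.mem_iUnion₂.1 (ht (Set.mem_univ σ))
    exact ⟨⟨τ, hτ⟩, h⟩
  have : Nonempty t := (hcover (Classical.arbitrary C)).nonempty
  let g : t → stdSimplex ℝ t → ℝ := fun i w => max (Φ (comb t w) i.1) 0
  have hg : ∀ i, Continuous (g i) := fun i =>
    ((hΦ i.1).comp (hcomb t)).max continuous_const
  have hg0 : ∀ i w, 0 ≤ g i w := fun i w => le_max_right _ _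
  have hgpos : ∀ w, 0 < ∑ i, g i w := by
    intro w
    obtain ⟨i, hi⟩ := hcover (comb t w)
    exact Finset.sum_pos' (fun j _ => hg0 j w) ⟨i, Finset.mem_univ i, lt_max_of_lt_left hi⟩
  let f : stdSimplex ℝ t → stdSimplex ℝ t := fun w =>
    ⟨fun i => g i w / ∑ j, g j w, fun i => div_nonneg (hg0 i w) (hgpos w).le, by
      rw [← Finset.sum_div, div_self (hgpos w).ne']⟩
  have hf : Continuous f := Continuous.subtype_mk (continuous_pi fun i =>
    (hg i).div (continuous_finsetSum _ fun j _ => hg j) fun w => (hgpos w).ne') _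
  obtain ⟨w, hw⟩ := stdSimplex.exists_fixedPoint hf
  have hwi : ∀ i, w.1 i = g i w / ∑ j, g j w := fun i => (congrArg (fun x => x.1 i) hw).symm
  -- At the fixed point the weights are proportional to the positive parts of `Φ`, so the average is
  -- a sum of squares over a positive total. Concavity would then make `Φ` positive on the diagonal.
  have hpos : 0 < ∑ i : t, w.1 i * Φ (comb t w) i.1 := by
    have hterm : ∀ i : t, w.1 i * Φ (comb t w) i.1 = g i w ^ 2 / ∑ j, g j w := by
      intro i
      rw [hwi i]
      rcases le_total (Φ (comb t w) i.1) 0 with h | h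
      · have : g i w = 0 := max_eq_right h
        simp [this]
      · have : g i w = Φ (comb t w) i.1 := max_eq_left h
        rw [← this]; ring
    obtain ⟨i, hi⟩ := hcover (comb t w)
    refine Finset.sum_pos' (fun j _ => ?_) ⟨i, Finset.mem_univ i, ?_⟩
    · rw [hterm]; exact div_nonneg (sq_nonneg _) (hgpos w).le
    · rw [hterm]
      exact div_pos (pow_pos (lt_max_of_lt_left hi) 2) (hgpos w)
  exact absurd (hdiag (comb t w)) (not_le.2 (hpos.trans_le (hconc t w (comb t w))))

/-! ### Continuity and concavity of the total gain -/

namespace MinGame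

variable {P : Type*} {k : ℕ} {G : MinGame P k} [∀ p, Fintype (G.S p)]

/-- The playerwise convex combination of finitely many plays. -/
noncomputable def Play.comb {ι : Type*} [Fintype ι] (ρ : ι → G.Play) (w : stdSimplex ℝ ι) :
    G.Play := fun p =>
  ⟨∑ i, w.1 i • (ρ i p).1, (convex_stdSimplex ℝ (G.S p)).sum_mem (fun i _ => w.2.1 i) w.2.2
    fun i _ => (ρ i p).2⟩

theorem Play.comb_apply {ι : Type*} [Fintype ι] (ρ : ι → G.Play) (w : stdSimplex ℝ ι) (p : P)
    (x : G.S p) : (Play.comb ρ w p).1 x = ∑ i, w.1 i * (ρ i p).1 x := by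
  simp [Play.comb, Finset.sum_apply]

theorem Play.continuous_comb {ι : Type*} [Fintype ι] (ρ : ι → G.Play) :
    Continuous (Play.comb ρ) := by
  refine continuous_pi fun p => Continuous.subtype_mk ?_ _
  refine continuous_finsetSum _ fun i _ => ?_
  have : Continuous fun w : stdSimplex ℝ ι => w.1 i :=
    (continuous_apply i).comp continuous_subtype_val
  exact this.smul continuous_const

variable [Fintype P] [DecidableEq P]

theorem continuous_expectation (f : (∀ p, G.S p) → ℝ) :
    Continuous fun σ : G.Play => expectation σ f := by
  refine continuous_finsetSum _ fun s _ => Continuous.mul ?_ continuous_const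
  refine continuous_finsetProd _ fun p _ => ?_
  exact (continuous_apply (s p)).comp (continuous_subtype_val.comp (continuous_apply p))

theorem continuous_payoff [NeZero k] (p : P) : Continuous fun σ : G.Play => payoff σ p :=
  Continuous.finset_inf'_apply _ fun i _ => continuous_expectation (G.u p i)

/-- Splitting off the factor of `p` from the product law makes the linearity in `τ` visible. -/
theorem expectation_update (σ : G.Play) (p : P) (τ : G.MixedStrategy p)
    (f : (∀ p, G.S p) → ℝ) :
    expectation (Function.update σ p τ) f =
      ∑ s, τ.1 (s p) * ((∏ q ∈ Finset.univ.erase p, (σ q).1 (s q)) * f s) := by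
  refine Finset.sum_congr rfl fun s _ => ?_
  change (∏ q, (Function.update σ p τ q).1 (s q)) * f s = _
  rw [← Finset.mul_prod_erase _ _ (Finset.mem_univ p), Function.update_self, mul_assoc]
  congr 2
  refine Finset.prod_congr rfl fun q hq => ?_
  rw [Function.update_of_ne (Finset.ne_of_mem_erase hq)]

theorem expectation_update_comb {ι : Type*} [Fintype ι] (σ : G.Play) (p : P) (ρ : ι → G.Play)
    (w : stdSimplex ℝ ι) (f : (∀ p, G.S p) → ℝ) :
    expectation (Function.update σ p (Play.comb ρ w p)) f =
      ∑ i, w.1 i * expectation (Function.update σ p (ρ i p)) f := by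
  simp only [expectation_update, Play.comb_apply, Finset.sum_mul, Finset.mul_sum]
  rw [Finset.sum_comm]
  simp only [mul_assoc]

/-- The payoff of a player is concave in her own mixed strategy. -/
theorem sum_payoff_update_le_comb [NeZero k] {ι : Type*} [Fintype ι] (σ : G.Play) (p : P)
    (ρ : ι → G.Play) (w : stdSimplex ℝ ι) :
    ∑ i, w.1 i * payoff (Function.update σ p (ρ i p)) p ≤
      payoff (Function.update σ p (Play.comb ρ w p)) p := by
  refine Finset.le_inf' _ _ fun j hj => ?_
  rw [expectation_update_comb]
  exact Finset.sum_le_sum fun i _ => mul_le_mul_of_nonneg_left (Finset.inf'_le _ hj) (w.2.1 i)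

/-- The total gain of the players when each of them, separately, changes from `σ` to `τ`. -/
noncomputable def totalGain [NeZero k] (σ τ : G.Play) : ℝ :=
  ∑ p, (payoff (Function.update σ p (τ p)) p - payoff σ p)

theorem continuous_totalGain [NeZero k] (τ : G.Play) :
    Continuous fun σ : G.Play => totalGain σ τ :=
  continuous_finsetSum _ fun p _ => ((continuous_payoff p).comp
    (continuous_id.update p continuous_const)).sub (continuous_payoff p)

theorem totalGain_self [NeZero k] (σ : G.Play) : totalGain σ σ = 0 := by
  simp [totalGain]

/-- The players other than `p` contribute zero, so a bound on the total gain bounds each unilateral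
gain. -/
theorem totalGain_update [NeZero k] (σ : G.Play) (p : P) (τ : G.MixedStrategy p) :
    totalGain σ (Function.update σ p τ) = payoff (Function.update σ p τ) p - payoff σ p := by
  rw [totalGain, Finset.sum_eq_single p, Function.update_self]
  · intro q _ hq
    rw [Function.update_of_ne hq, Function.update_eq_self, sub_self]
  · exact fun h => absurd (Finset.mem_univ p) h

theorem sum_totalGain_le_comb [NeZero k] {ι : Type*} [Fintype ι] (σ : G.Play) (ρ : ι → G.Play)
    (w : stdSimplex ℝ ι) :
    ∑ i, w.1 i * totalGain σ (ρ i) ≤ totalGain σ (Play.comb ρ w) := by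
  simp only [totalGain, Finset.mul_sum]
  rw [Finset.sum_comm]
  refine Finset.sum_le_sum fun p _ => ?_
  simp only [mul_sub, Finset.sum_sub_distrib]
  rw [← Finset.sum_mul, w.2.2, one_mul]
  exact sub_le_sub_right (sum_payoff_update_le_comb σ p ρ w) _

end MinGame

/-! ### Existence of an equilibrium -/

theorem mainTheorem1 {P : Type*} [Fintype P] [DecidableEq P] {k : ℕ} [NeZero k]
    (G : MinGame P k) [∀ p, Fintype (G.S p)] [∀ p, Nonempty (G.S p)] :
    ∃ σ : G.Play, MinGame.IsEquilibrium σ := by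
  obtain ⟨σ, hσ⟩ := exists_forall_nonpos_of_concave (C := G.Play)
    (fun t => MinGame.Play.comb fun i : t => i.1) (fun t => MinGame.Play.continuous_comb _)
    MinGame.totalGain MinGame.continuous_totalGain (fun σ => (MinGame.totalGain_self σ).le)
    (fun t w σ => MinGame.sum_totalGain_le_comb σ _ w)
  refine ⟨σ, fun p τ => ?_⟩
  have := hσ (Function.update σ p τ)
  rw [MinGame.totalGain_update] at this
  exact sub_nonpos.1 this
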